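/- Let $\Lambda\subset\mathbb C$ be a lattice and let $\mathcal N$ be a finite bipartite perfect network embedded in the flat torus $T=\mathbb C/\Lambda$ with straight (geodesic) edges: $\mathcal N$ is a directed graph whose edges join white and black vertices, every white vertex has exactly one incoming edge, and every black vertex has exactly one outgoing edge. Let the rim $R$ be a non-contractible simple loop on $T$ which contains no vertex of $\mathcal N$, and assume that $\mathcal N$ and $R$ are in normalized position: every edge meeting $R$ meets it exactly once and is oriented from black to white; all edges meeting $R$ are parallel and point in the same direction $v\ne 0$; and $R$ is transversal to this direction, that is, every line in $\mathbb C$ parallel to $v$ meets each lift of $R$ to $\mathbb C$ in at most one point. (So all intersections of edges with $R$ have the same sign, and if $T$ is cut along $R$, one gets a network on a cylinder in which each edge meeting $R$ is cut into an edge from a source to a white vertex and an edge from a black vertex to a sink.) For an edge $e$ from a white to a black vertex let $e_-$ be its unique predecessor (the edge ending at the white endpoint of $e$) and $e_+$ its unique successor (the edge starting at the black endpoint of $e$), let $\alpha_-,\alpha_+\in(-\pi,\pi)$ be the signed angles from the vector $e_-$ to $e$ and from $e$ to $e_+$, and put $\mathrm{turn}(e)=\exp\bigl(\tfrac{\mathrm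 i}{2}(\alpha_-+\alpha_+)\bigr)$. The sign of a directed path $\gamma$ from a source to a sink in the network on the cylinder is defined by two rules: 1. if $\gamma$ is simple on the universal covering of the cylinder, its sign is $+1$; 2. if $\gamma$ can be decomposed into a path $\gamma'$ from a source to a sink and a contractible cycle that is simple on the universal covering, then the signs of $\gamma$ and $\gamma'$ are opposite. Then these rules assign exactly one sign to every directed path $\gamma$ from a source to a sink, and this sign is equal to the product, with multiplicities, of the turning numbers $\mathrm{turn}(e)$ of all white-to-black edges $e$ on $\gamma$. -/

import Mathlib

noncomputable section

/-- The two colours of vertices. -/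
inductive VertexColor
  | white
  | black

/-- A bipartite perfect network (a directed multigraph with vertex set `V` and edge set `E`)
embedded in the flat torus `ℂ ⧸ Λ` with straight edges. The edge `e` is drawn as the geodesic
`t ↦ pos (src e) + t • vec e`, `0 ≤ t ≤ 1`; here `vec e` is the vector in the plane which
represents `e` on the universal covering `ℂ` of the torus. -/
structure FlatPerfectNetwork (Λ : Submodule ℤ ℂ) (V E : Type*) where
  src : E → V
  tgt : E → V
  color : V → VertexColor
  /-- Every edge joins vertices of different colours. -/
  bipartite : ∀ e, color (src e) ≠ color (tgt e)
  /-- White vertices have exactly one incoming edge. -/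
  white_in : ∀ v, color v = VertexColor.white → ∃! e, tgt e = v
  /-- Black vertices have exactly one outgoing edge. -/
  black_out : ∀ v, color v = VertexColor.black → ∃! e, src e = v
  pos : V → ℂ ⧸ Λ
  vec : E → ℂ
  pos_tgt : ∀ e, pos (tgt e) = pos (src e) + Λ.mkQ (vec e)
  /-- Distinct vertices are distinct points. -/
  pos_injective : Function.Injective pos
  /-- An interior point of an edge lies on no other edge, is no vertex, and is passed only once
  by its own edge. -/
  embedded : ∀ e f : E, ∀ t u : ℝ, 0 < t → t < 1 → 0 ≤ u → u ≤ 1 →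
    pos (src e) + Λ.mkQ (t • vec e) = pos (src f) + Λ.mkQ (u • vec f) → e = f ∧ t = u

/-- An oriented non-contractible simple loop on the torus `ℂ ⧸ Λ`, given by a lift `ℝ → ℂ`; the
loop itself is `s ↦ Λ.mkQ (lift s)` and has period `1`. -/
structure SimpleLoop (Λ : Submodule ℤ ℂ) where
  lift : ℝ → ℂ
  continuous_lift : Continuous lift
  period : ℂ
  period_mem : period ∈ Λ
  period_ne_zero : period ≠ 0
  lift_add_one : ∀ s, lift (s + 1) = lift s + period
  simple : ∀ s s' : ℝ, Λ.mkQ (lift s) = Λ.mkQ (lift s') → ∃ n : ℤ, s - s' = n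

/-- The oriented area `a × b` of the parallelogram spanned by two vectors of the plane. For fixed
`a ≠ 0`, two points lie on the same line parallel to `a` iff they have the same image. -/
def planeCross (a b : ℂ) : ℝ := a.re * b.im - a.im * b.re

namespace FlatPerfectNetwork

variable {Λ : Submodule ℤ ℂ} {V E : Type*} (N : FlatPerfectNetwork Λ V E)

/-- The point of the edge `e` with parameter `t ∈ [0, 1]` lies on the loop `R`. -/
def MeetsAt (R : SimpleLoop Λ) (e : E) (t : ℝ) : Prop :=
  0 ≤ t ∧ t ≤ 1 ∧ ∃ s : ℝ, N.pos (N.src e) + Λ.mkQ (t • N.vec e) = Λ.mkQ (R.lift s)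

/-- The edge `e` crosses the loop `R`. -/
def Crosses (R : SimpleLoop Λ) (e : E) : Prop := ∃ t, N.MeetsAt R e t

/-- The network and the rim `R` are in normalized position, with `v` the common direction of the
edges which cross the rim.

A crossing edge meets the rim once and is oriented from black to white. When the torus is cut
along the rim it therefore breaks into one edge from a source to a white vertex and one edge from
a black vertex to a sink. The rim is transversal to the direction `v`: a line parallel to `v`
meets a lift of the rim to the plane at most once. As all crossing edges are positive multiples
of `v`, all intersections of edges with the rim then have the same sign, so the rim is ideal. -/
structure IsNormalized (R : SimpleLoop Λ) (v : ℂ) : Prop where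
  vertices_off_rim : ∀ (x : V) (s : ℝ), N.pos x ≠ Λ.mkQ (R.lift s)
  meets_once : ∀ e t u, N.MeetsAt R e t → N.MeetsAt R e u → t = u
  black_to_white : ∀ e, N.Crosses R e → N.color (N.src e) = VertexColor.black
  parallel : ∀ e, N.Crosses R e → ∃ c : ℝ, 0 < c ∧ N.vec e = c • v
  transversal : Function.Injective fun s => planeCross v (R.lift s)

lemma color_tgt_of_white {e : E} (h : N.color (N.src e) = VertexColor.white) :
    N.color (N.tgt e) = VertexColor.black := by
  have hb := N.bipartite e
  cases ht : N.color (N.tgt e)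
  · exact absurd (h.trans ht.symm) hb
  · rfl

/-- The unique predecessor of a white-to-black edge. -/
def predEdge (e : E) (h : N.color (N.src e) = VertexColor.white) : E :=
  (N.white_in (N.src e) h).choose

/-- The unique successor of a white-to-black edge. -/
def succEdge (e : E) (h : N.color (N.src e) = VertexColor.white) : E :=
  (N.black_out (N.tgt e) (N.color_tgt_of_white h)).choose

/-- The signed angle from the vector `a` to the vector `b`. -/
def signedAngle (a b : ℂ) : ℝ := Complex.arg (b / a)

/-- The turning number `exp ((i / 2) (α₋ + α₊))` of a white-to-black edge. -/
def turn (e : E) (h : N.color (N.src e) = VertexColor.white) : ℂ :=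
  Complex.exp (Complex.I / 2 *
    ((signedAngle (N.vec (N.predEdge e h)) (N.vec e) +
      signedAngle (N.vec e) (N.vec (N.succEdge e h)) : ℝ) : ℂ))

/-- A directed path from a source to a sink in the network on the cylinder obtained by cutting the
torus along the rim `R`. Sources and sinks correspond to the edges crossing the rim. The path
starts along the second half of the crossing edge `source`, follows the edges `mid`, which do not
cross the rim, and ends along the first half of the crossing edge `sink`. -/
structure CylinderPath (R : SimpleLoop Λ) where
  source : E
  mid : List E
  sink : E
  source_crosses : N.Crosses R source
  sink_crosses : N.Crosses R sink
  mid_not_crosses : ∀ e ∈ mid, ¬ N.Crosses R e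
  chain : List.IsChain (fun e f => N.tgt e = N.src f) (source :: (mid ++ [sink]))

/-- The displacement, in the universal covering, along a directed path. -/
def displacement (l : List E) : ℂ := (l.map N.vec).sum

/-- A path from a source to a sink is simple on the universal covering: the lifted path visits no
vertex twice. If the first vertex is lifted to `z : ℂ`, then the `i`-th one is lifted to
`z + displacement (mid.take i)`. (The universal covering of the cylinder is a connected component
of the plane minus all lifts of the rim.) -/
def CylinderPath.IsSimple {N : FlatPerfectNetwork Λ V E} {R : SimpleLoop Λ}
    (γ : N.CylinderPath R) : Prop :=
  ∀ i j, i < j → j ≤ γ.mid.length →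
    N.displacement (γ.mid.take i) ≠ N.displacement (γ.mid.take j)

/-- A directed path is a contractible cycle which is simple (on the universal covering): its lift
returns to the starting point, and visits no vertex twice before that. -/
def IsContractibleSimpleCycle (c : List E) : Prop :=
  c ≠ [] ∧ N.displacement c = 0 ∧
    ∀ i j, i < j → j < c.length → N.displacement (c.take i) ≠ N.displacement (c.take j)

/-- The path `γ` decomposes into the path `γ'` and a contractible simple cycle. -/
def CylinderPath.DecomposesInto {N : FlatPerfectNetwork Λ V E} {R : SimpleLoop Λ}
    (γ γ' : N.CylinderPath R) : Prop :=
  γ.source = γ'.source ∧ γ.sink = γ'.sink ∧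
    ∃ a c b : List E, γ.mid = a ++ c ++ b ∧ γ'.mid = a ++ b ∧ N.IsContractibleSimpleCycle c

/-- The modified concordance sign of a path from a source to a sink, as the relation generated by
the two inductive rules. -/
inductive HasSign {N : FlatPerfectNetwork Λ V E} {R : SimpleLoop Λ} :
    N.CylinderPath R → ℤˣ → Prop
  | simple (γ : N.CylinderPath R) : γ.IsSimple → HasSign γ 1
  | cycle (γ γ' : N.CylinderPath R) (ε : ℤˣ) :
      γ.DecomposesInto γ' → HasSign γ' ε → HasSign γ (-ε)

open Classical in
/-- The product of the turning numbers of all white-to-black edges of a path (with multiplicity;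
the edges `source` and `sink` are included in the list of all edges of the path). -/
def CylinderPath.turnProduct {N : FlatPerfectNetwork Λ V E} {R : SimpleLoop Λ}
    (γ : N.CylinderPath R) : ℂ :=
  ((γ.source :: (γ.mid ++ [γ.sink])).map fun e =>
    if h : N.color (N.src e) = VertexColor.white then N.turn e h else 1).prod

end FlatPerfectNetwork

end

/-! Colours alternate along a path, and its first and last edges start at black vertices. Hence each
angle between consecutive edges is counted by exactly one white-to-black edge, and the product of
turning numbers is exp(iθ/2), where θ is the total turning (`prod_edgeTurn`). It remains to see that
exp(iθ/2) obeys both sign rules. Every path gets a sign by cutting out cycles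
(`exists_decomposesInto`), and any such sign must equal exp(iθ/2), which gives uniqueness and the
formula together.

Both rules rest on Hopf's secant argument (`sum_arg_turning_eq`): the turning of a simple broken
line is the turning of the chords from its first vertex plus that of the chords to its last vertex.
For a simple closed polygon this gives exp(iθ/2) = -1 (`exp_half_turning_of_closed`), and
perfectness of the network makes the insertion of a cycle add exactly its closed turning
(`exp_half_angleSum_insert`). For a simple path from source to sink, the lifts of the rim crossed by
the first and last edges keep these chords from pointing along -v. Their arguments relative to v
therefore never jump, and the two contributions cancel, so θ = 0 (`angleSum_edges_of_isSimple`). -/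

noncomputable section TurningNumbers

open Complex Finset

/-! ### Arguments of quotients of plane vectors -/

/-- The value of the linear functional with coefficient `w` is the real part of a product. -/
lemma exists_eq_re_mul (f : ℂ →L[ℝ] ℝ) : ∃ w : ℂ, ∀ z, f z = (z * w).re := by
  refine ⟨⟨f 1, -f I⟩, fun z => ?_⟩
  have hz : z = z.re • (1 : ℂ) + z.im • I := by
    apply Complex.ext <;> simp
  conv_lhs => rw [hz, map_add, map_smul, map_smul]
  simp

/-- Multiplication by `w` moves both vectors into the open right half-plane, where arguments lie in
(-π/2, π/2), so their difference does not wrap around. -/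
lemma arg_div_of_re_mul_pos {a b w : ℂ} (ha : 0 < (a * w).re) (hb : 0 < (b * w).re) :
    arg (b / a) = arg (b * w) - arg (a * w) := by
  have ha0 : a * w ≠ 0 := by rintro h; simp [h] at ha
  have hb0 : b * w ≠ 0 := by rintro h; simp [h] at hb
  have hw : w ≠ 0 := right_ne_zero_of_mul ha0
  have h1 := abs_lt.1 (abs_arg_lt_pi_div_two_iff.2 (Or.inl ha))
  have h2 := abs_lt.1 (abs_arg_lt_pi_div_two_iff.2 (Or.inl hb))
  have hinv : arg (a * w)⁻¹ = -arg (a * w) := by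
    rw [arg_inv, if_neg]
    linarith [Real.pi_pos]
  have : b / a = (b * w) * (a * w)⁻¹ := by
    have := left_ne_zero_of_mul ha0
    field_simp
  rw [this, (arg_mul_eq_add_arg_iff hb0 (inv_ne_zero ha0)).2, hinv]
  · ring
  · rw [hinv]
    constructor <;> linarith [Real.pi_pos]

lemma exists_re_mul_pos_of_zero_notMem {K : Set ℂ} (hc : Convex ℝ K) (hK : IsCompact K)
    (h : (0 : ℂ) ∉ K) : ∃ w : ℂ, ∀ z ∈ K, 0 < (z * w).re := by
  obtain ⟨f, u, hu, hf⟩ := geometric_hahn_banach_point_closed hc hK.isClosed h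
  obtain ⟨w, hw⟩ := exists_eq_re_mul f
  refine ⟨w, fun z hz => ?_⟩
  rw [← hw]
  simp only [map_zero] at hu
  exact hu.trans (hf z hz)

lemma isCompact_segment (a b : ℂ) : IsCompact (segment ℝ a b) := by
  rw [segment_eq_image]
  exact isCompact_Icc.image (by fun_prop)

lemma exists_re_mul_pos_of_segment {a b : ℂ} (h : (0 : ℂ) ∉ segment ℝ a b) :
    ∃ w : ℂ, ∀ z ∈ segment ℝ a b, 0 < (z * w).re :=
  exists_re_mul_pos_of_zero_notMem (convex_segment a b) (isCompact_segment a b) h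

/-- A segment avoiding the origin lies in an open half-plane through it, where angles add; the
positive ray of `c` meets the segment, so `c` lies there too. -/
lemma arg_div_add_arg_div {a b c : ℂ} (h : (0 : ℂ) ∉ segment ℝ a b)
    (hc : ∃ r : ℝ, 0 < r ∧ r • c ∈ segment ℝ a b) :
    arg (c / a) + arg (b / c) = arg (b / a) := by
  obtain ⟨w, hw⟩ := exists_re_mul_pos_of_segment h
  obtain ⟨r, hr, hrc⟩ := hc
  have ha := hw a (left_mem_segment ℝ a b)
  have hb := hw b (right_mem_segment ℝ a b)
  have hc' : 0 < (c * w).re := by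
    have := hw _ hrc
    rw [smul_mul_assoc, smul_re, smul_eq_mul] at this
    exact (pos_iff_pos_of_mul_pos this).1 hr
  rw [arg_div_of_re_mul_pos ha hb, arg_div_of_re_mul_pos ha hc', arg_div_of_re_mul_pos hc' hb]
  ring

lemma arg_div_add_arg_div_of_add {a b : ℂ} (h : (0 : ℂ) ∉ segment ℝ a b) :
    arg ((a + b) / a) + arg (b / (a + b)) = arg (b / a) := by
  refine arg_div_add_arg_div h ⟨1 / 2, by norm_num, 1 / 2, 1 / 2, by norm_num, by norm_num,
    by norm_num, ?_⟩
  rw [smul_add]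

/-- The winding number around the origin of the boundary of a parallelogram which does not
contain the origin vanishes. -/
lemma arg_div_add_arg_div_square {a a' b b' : ℂ}
    (h : Disjoint (segment ℝ a a') (segment ℝ b b')) :
    arg ((b' - a) / (b - a)) + arg ((b' - a') / (b' - a)) =
      arg ((b - a') / (b - a)) + arg ((b' - a') / (b - a')) := by
  obtain ⟨f, u, u', hf, huu, hf'⟩ := geometric_hahn_banach_compact_closed (convex_segment a a')
    (isCompact_segment a a') (convex_segment b b') (isCompact_segment b b').isClosed h
  obtain ⟨w, hw⟩ := exists_eq_re_mul f
  -- Strict separation of the two segments puts all four differences into one half-plane.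
  have key : ∀ x ∈ segment ℝ a a', ∀ y ∈ segment ℝ b b', 0 < ((y - x) * w).re := by
    intro x hx y hy
    rw [← hw, map_sub]
    linarith [hf x hx, hf' y hy]
  have h1 := key a (left_mem_segment ℝ _ _) b (left_mem_segment ℝ _ _)
  have h2 := key a (left_mem_segment ℝ _ _) b' (right_mem_segment ℝ _ _)
  have h3 := key a' (right_mem_segment ℝ _ _) b (left_mem_segment ℝ _ _)
  have h4 := key a' (right_mem_segment ℝ _ _) b' (right_mem_segment ℝ _ _)
  rw [arg_div_of_re_mul_pos h1 h2, arg_div_of_re_mul_pos h2 h4, arg_div_of_re_mul_pos h1 h3,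
    arg_div_of_re_mul_pos h3 h4]
  ring

lemma arg_inv_of_mem_slitPlane {a : ℂ} (ha : a ∈ slitPlane) : arg a⁻¹ = -arg a := by
  rw [arg_inv, if_neg (mem_slitPlane_iff_arg.1 ha).1]

lemma arg_div_of_segment_subset_slitPlane {a b : ℂ} (h : segment ℝ a b ⊆ slitPlane) :
    arg (b / a) = arg b - arg a := by
  have ha := h (left_mem_segment ℝ a b)
  have hb := h (right_mem_segment ℝ a b)
  have hpa := (mem_slitPlane_iff_arg.1 ha).1
  have hpb := (mem_slitPlane_iff_arg.1 hb).1
  have ha0 := slitPlane_ne_zero ha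
  have hb0 := slitPlane_ne_zero hb
  -- End-points on the same side of the real axis: the difference of arguments is already in the
  -- principal range.
  have same : -Real.pi < arg b - arg a → arg b - arg a ≤ Real.pi →
      arg (b / a) = arg b - arg a := by
    intro h1 h2
    rw [div_eq_mul_inv, (arg_mul_eq_add_arg_iff hb0 (inv_ne_zero ha0)).2,
      arg_inv_of_mem_slitPlane ha]
    · ring
    · rw [arg_inv_of_mem_slitPlane ha]
      constructor <;> linarith
  -- Otherwise the segment crosses the real axis at some `m`, necessarily on its positive half, and
  -- the angle splits at `m`.
  have opposite : (0 : ℝ) ∈ segment ℝ a.im b.im → arg (b / a) = arg b - arg a := by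
    rintro ⟨x, y, hx, hy, hxy, h0⟩
    have hm : x • a + y • b ∈ segment ℝ a b := ⟨x, y, hx, hy, hxy, rfl⟩
    have him : (x • a + y • b).im = 0 := by simpa using h0
    set m := x • a + y • b with hmdef
    have hre : 0 < m.re := by
      rcases mem_slitPlane_iff.1 (h hm) with h' | h'
      · exact h'
      · exact absurd him h'
    have hmr : m = (m.re : ℂ) := Complex.ext (by simp) (by simpa using him)
    rw [← arg_div_add_arg_div (fun h' => slitPlane_ne_zero (h h') rfl)
      (c := m) ⟨1, one_pos, by rwa [one_smul]⟩, hmr]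
    rw [div_eq_mul_inv, arg_real_mul _ hre, arg_inv_of_mem_slitPlane ha, div_eq_mul_inv,
      ← ofReal_inv, mul_comm, arg_real_mul _ (inv_pos.2 hre)]
    ring
  have la := neg_pi_lt_arg a
  have lb := neg_pi_lt_arg b
  have ua := lt_of_le_of_ne (arg_le_pi a) hpa
  have ub := lt_of_le_of_ne (arg_le_pi b) hpb
  rcases lt_or_ge a.im 0 with h1 | h1 <;> rcases lt_or_ge b.im 0 with h2 | h2
  · have := arg_neg_iff.2 h1
    have := arg_neg_iff.2 h2
    exact same (by linarith) (by linarith)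
  · exact opposite (by rw [segment_eq_Icc (h1.le.trans h2)]; exact ⟨h1.le, h2⟩)
  · exact opposite (by
      rw [segment_symm, segment_eq_Icc (h2.le.trans h1)]; exact ⟨h2.le, h1⟩)
  · have := arg_nonneg_iff.2 h1
    have := arg_nonneg_iff.2 h2
    exact same (by linarith) (by linarith)

/-- The total change of the argument along a broken line which stays in the slit plane. -/
lemma sum_arg_div_of_segment_subset_slitPlane (w : ℕ → ℂ) (n : ℕ)
    (h : ∀ i < n, segment ℝ (w i) (w (i + 1)) ⊆ slitPlane) :
    ∑ i ∈ range n, arg (w (i + 1) / w i) = arg (w n) - arg (w 0) := by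
  rw [← sum_range_sub (fun i => arg (w i))]
  exact sum_congr rfl fun i hi =>
    arg_div_of_segment_subset_slitPlane (h i (mem_range.1 hi))

/-! ### Hopf's secant argument for broken lines and polygons -/

/-- The change of the total turning of the chords which end at a fixed vertex of a broken line,
when this vertex is moved along an edge. -/
lemma sum_arg_chord_step (z : ℕ → ℂ) (m : ℕ)
    (hd : ∀ i < m, Disjoint (segment ℝ (z i) (z (i + 1))) (segment ℝ (z (m + 1)) (z (m + 2))))
    (hc : (0 : ℂ) ∉ segment ℝ (z (m + 1) - z m) (z (m + 2) - z (m + 1))) :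
    ∑ i ∈ range (m + 1), arg ((z (m + 2) - z (i + 1)) / (z (m + 2) - z i)) =
      ∑ i ∈ range m, arg ((z (m + 1) - z (i + 1)) / (z (m + 1) - z i)) +
      arg ((z (m + 2) - z (m + 1)) / (z (m + 1) - z m)) -
      arg ((z (m + 2) - z 0) / (z (m + 1) - z 0)) := by
  have h1 : ∑ i ∈ range m, arg ((z (m + 2) - z (i + 1)) / (z (m + 2) - z i)) =
      ∑ i ∈ range m, arg ((z (m + 1) - z (i + 1)) / (z (m + 1) - z i)) +
      (arg ((z (m + 2) - z m) / (z (m + 1) - z m)) -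
        arg ((z (m + 2) - z 0) / (z (m + 1) - z 0))) := by
    -- Each chord angle changes by the parallelogram identity, and the corrections telescope.
    rw [← sum_range_sub (fun i => arg ((z (m + 2) - z i) / (z (m + 1) - z i))),
      ← sum_add_distrib]
    refine sum_congr rfl fun i hi => ?_
    linarith [arg_div_add_arg_div_square (hd i (mem_range.1 hi))]
  have h2 := arg_div_add_arg_div_of_add hc
  rw [show z (m + 1) - z m + (z (m + 2) - z (m + 1)) = z (m + 2) - z m by ring] at h2
  rw [sum_range_succ, h1]
  linarith

/-- Hopf's formula for the total turning of a simple broken line with `n + 1` edges. -/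
theorem sum_arg_turning_eq (z : ℕ → ℂ) (n : ℕ)
    (hd : ∀ i j, i + 1 < j → j ≤ n →
      Disjoint (segment ℝ (z i) (z (i + 1))) (segment ℝ (z j) (z (j + 1))))
    (hc : ∀ i < n, (0 : ℂ) ∉ segment ℝ (z (i + 1) - z i) (z (i + 2) - z (i + 1))) :
    ∑ i ∈ range n, arg ((z (i + 2) - z (i + 1)) / (z (i + 1) - z i)) =
      ∑ j ∈ range n, arg ((z (j + 2) - z 0) / (z (j + 1) - z 0)) +
      ∑ i ∈ range n, arg ((z (n + 1) - z (i + 1)) / (z (n + 1) - z i)) := by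
  induction n with
  | zero => simp
  | succ m ih =>
    -- Appending an edge changes the chords to the last vertex by the new corner angle minus the new
    -- term of the first sum.
    have := sum_arg_chord_step z m (fun i hi => hd i (m + 1) (by omega) le_rfl) (hc m (by omega))
    rw [sum_range_succ, ih (fun i j h h' => hd i j h (by omega)) (fun i hi => hc i (by omega)),
      sum_range_succ (fun j => arg ((z (j + 2) - z 0) / (z (j + 1) - z 0)))]
    linarith

lemma exp_arg_mul_I_eq_div_norm (a : ℂ) (ha : a ≠ 0) : exp (arg a * I) = a / ‖a‖ := by
  have h : (‖a‖ : ℂ) ≠ 0 := by simpa using ha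
  rw [eq_div_iff h, mul_comm, norm_mul_exp_arg_mul_I]

lemma exp_sum_arg_div_mul_I (w : ℕ → ℂ) (n : ℕ) (h : ∀ i ≤ n, w i ≠ 0) :
    exp ((∑ i ∈ range n, arg (w (i + 1) / w i) : ℝ) * I) = exp (arg (w n / w 0) * I) := by
  induction n with
  | zero => simp [h 0 le_rfl]
  | succ m ih =>
    have h0 := h 0 (by omega)
    have h1 := h m (by omega)
    have h2 := h (m + 1) le_rfl
    have h0' : (‖w 0‖ : ℂ) ≠ 0 := by simpa using h0
    have h1' : (‖w m‖ : ℂ) ≠ 0 := by simpa using h1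
    have h2' : (‖w (m + 1)‖ : ℂ) ≠ 0 := by simpa using h2
    rw [sum_range_succ, ofReal_add, add_mul, exp_add, ih fun i hi => h i (by omega),
      exp_arg_mul_I_eq_div_norm _ (div_ne_zero h1 h0),
      exp_arg_mul_I_eq_div_norm _ (div_ne_zero h2 h1),
      exp_arg_mul_I_eq_div_norm _ (div_ne_zero h2 h0)]
    simp only [norm_div, ofReal_div]
    field_simp

/-- The rotation number of a simple closed polygon with `n + 3` edges is odd. -/
theorem exp_half_turning_of_closed (z : ℕ → ℂ) (n : ℕ) (hz : z (n + 3) = z 0)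
    (hd : ∀ i j, i + 1 < j → j ≤ n + 2 → (i, j) ≠ (0, n + 2) →
      Disjoint (segment ℝ (z i) (z (i + 1))) (segment ℝ (z j) (z (j + 1))))
    (hc : ∀ i < n + 2, (0 : ℂ) ∉ segment ℝ (z (i + 1) - z i) (z (i + 2) - z (i + 1)))
    (hc' : (0 : ℂ) ∉ segment ℝ (z (n + 3) - z (n + 2)) (z 1 - z 0))
    (hne : ∀ i, 0 < i → i < n + 3 → z i ≠ z 0) :
    exp (I / 2 * ((∑ i ∈ range (n + 2), arg ((z (i + 2) - z (i + 1)) / (z (i + 1) - z i)) +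
      arg ((z 1 - z 0) / (z (n + 3) - z (n + 2))) : ℝ) : ℂ)) = -1 := by
  -- The closing edge is left out, since it touches the first edge; the chord step `h2`, started at
  -- `z 1`, then moves the last vertex along it to `z 0`.
  have h1 := sum_arg_turning_eq z (n + 1) (fun i j h h' => hd i j h (by omega) (by
    simp only [ne_eq, Prod.mk.injEq]; omega)) (fun i hi => hc i (by omega))
  have h2 := sum_arg_chord_step (fun i => z (i + 1)) n
    (fun i hi => hd (i + 1) (n + 2) (by omega) le_rfl (by simp)) (hc (n + 1) (by omega))
  simp only [add_assoc, Nat.reduceAdd, zero_add] at h1 h2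
  rw [sum_range_succ' (fun i => arg ((z (n + 2) - z (i + 1)) / (z (n + 2) - z i)))] at h1
  simp only [add_assoc, Nat.reduceAdd, zero_add] at h1
  have hq := hne 1 (by omega) (by omega)
  have hp := hne (n + 2) (by omega) (by omega)
  set q := z 1 - z 0 with hqdef
  set p := z (n + 2) - z 0 with hpdef
  have hq0 : q ≠ 0 := sub_ne_zero.2 hq
  have hp0 : p ≠ 0 := sub_ne_zero.2 hp
  -- As `z (n + 3) = z 0`, chords to the last vertex are negatives of chords from the first, so both
  -- chord sums have the same value φ.
  have hφ : ∑ i ∈ range (n + 1), arg ((z (n + 3) - z (i + 2)) / (z (n + 3) - z (i + 1))) =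
      ∑ j ∈ range (n + 1), arg ((z (j + 2) - z 0) / (z (j + 1) - z 0)) := by
    refine sum_congr rfl fun i _ => ?_
    rw [hz, ← neg_sub (z (i + 2)), ← neg_sub (z (i + 1)), neg_div_neg_eq]
  set φ := ∑ j ∈ range (n + 1), arg ((z (j + 2) - z 0) / (z (j + 1) - z 0)) with hφdef
  have hexp : exp ((φ : ℝ) * I) = exp (arg (p / q) * I) :=
    exp_sum_arg_div_mul_I (fun i => z (i + 1) - z 0) (n + 1)
      (fun i hi => sub_ne_zero.2 (hne (i + 1) (by omega) (by omega)))
  have hpq : z (n + 2) - z 1 = p + -q := by simp only [hpdef, hqdef]; ring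
  have hcorner : (0 : ℂ) ∉ segment ℝ p (-q) := by
    rintro ⟨a, b, ha, hb, hab, h⟩
    refine hc' ⟨a, b, ha, hb, hab, ?_⟩
    rw [hz, ← neg_sub, ← hpdef, smul_neg]
    rw [smul_neg] at h
    linear_combination -h
  have htri := arg_div_add_arg_div_of_add hcorner
  have hlast : q / (z (n + 3) - z (n + 2)) = -q / p := by
    rw [hz, ← neg_sub (z (n + 2)), ← hpdef, div_neg, neg_div]
  have hend : z (n + 3) - z 1 = -q := by rw [hz, hqdef]; ring
  rw [hlast]
  rw [hpq] at h1 h2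
  rw [hend] at h2
  -- Halving the total gives φ + arg(-q/p). Since exp(iφ) is the direction of p/q, the product of
  -- directions is that of -1.
  have htotal : ∑ i ∈ range (n + 2), arg ((z (i + 2) - z (i + 1)) / (z (i + 1) - z i)) +
      arg (-q / p) = 2 * φ + 2 * arg (-q / p) := by
    rw [sum_range_succ]
    simp only [add_assoc, Nat.reduceAdd]
    rw [hφ] at h2
    linarith
  rw [htotal, show I / 2 * ((2 * φ + 2 * arg (-q / p) : ℝ) : ℂ) =
    (φ : ℝ) * I + arg (-q / p) * I by push_cast; ring, exp_add, hexp,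
    exp_arg_mul_I_eq_div_norm _ (div_ne_zero hp0 hq0),
    exp_arg_mul_I_eq_div_norm _ (div_ne_zero (neg_ne_zero.2 hq0) hp0)]
  have hq' : (‖q‖ : ℂ) ≠ 0 := by simpa using hq0
  have hp' : (‖p‖ : ℂ) ≠ 0 := by simpa using hp0
  simp only [norm_div, ofReal_div, norm_neg]
  field_simp

/-! ### The height above the rim -/

lemma planeCross_add (v a b : ℂ) : planeCross v (a + b) = planeCross v a + planeCross v b := by
  simp only [planeCross, add_re, add_im]; ring

lemma planeCross_sub (v a b : ℂ) : planeCross v (a - b) = planeCross v a - planeCross v b := by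
  simp only [planeCross, sub_re, sub_im]; ring

lemma planeCross_smul_self (v : ℂ) (t : ℝ) : planeCross v (t • v) = 0 := by
  simp only [planeCross, smul_re, smul_im, smul_eq_mul]; ring

lemma continuous_planeCross (v : ℂ) : Continuous (planeCross v) := by
  unfold planeCross; fun_prop

lemma eq_re_div_smul_of_planeCross_eq_zero {v a : ℂ} (hv : v ≠ 0) (h : planeCross v a = 0) :
    a = (a / v).re • v := by
  have him : (a / v).im = 0 := by
    rw [div_im, ← sub_div]
    simp only [planeCross] at h
    rw [show a.im * v.re - a.re * v.im = 0 by linarith, zero_div]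
  have : a / v = ((a / v).re : ℂ) := Complex.ext (by simp) (by simpa using him)
  rw [real_smul, ← this, div_mul_cancel₀ _ hv]

lemma exists_continuous_rightInverse {g : ℝ → ℝ} (hg : Continuous g)
    (hi : Function.Injective g) (hs : Function.Surjective g) :
    ∃ σ : ℝ → ℝ, Continuous σ ∧ Function.RightInverse σ g := by
  rcases hg.strictMono_of_inj hi with h | h
  · let φ := h.orderIsoOfSurjective g hs
    exact ⟨φ.symm, φ.symm.continuous, fun x => φ.apply_symm_apply x⟩
  · let φ := h.neg.orderIsoOfSurjective (fun x => -g x) fun y => by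
      obtain ⟨x, hx⟩ := hs (-y)
      exact ⟨x, by simp [hx]⟩
    refine ⟨fun y => φ.symm (-y), φ.symm.continuous.comp continuous_neg, fun x => ?_⟩
    have : -g (φ.symm (-x)) = -x := φ.apply_symm_apply (-x)
    exact neg_injective this

/-- Injectivity forces `c ≠ 0`, so the values at the integers are unbounded in both directions and
the intermediate value theorem applies. -/
lemma surjective_of_map_add_one {g : ℝ → ℝ} (hg : Continuous g) (hi : Function.Injective g)
    {c : ℝ} (h : ∀ s, g (s + 1) = g s + c) : Function.Surjective g := by
  have hc : c ≠ 0 := by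
    rintro rfl
    have := hi (show g (0 + 1) = g 0 by rw [h, add_zero])
    norm_num at this
  have hz : ∀ n : ℤ, g n = g 0 + n * c := by
    intro n
    induction n using Int.induction_on with
    | zero => simp
    | succ n ih => push_cast at ih ⊢; rw [h, ih]; ring
    | pred n ih =>
      have := h ((-n - 1 : ℤ) : ℝ)
      push_cast at this ih ⊢
      rw [sub_add_cancel, ih] at this
      linarith
  intro y
  obtain ⟨m, hm⟩ := exists_int_lt ((y - g 0) / c)
  obtain ⟨n, hn⟩ := exists_int_gt ((y - g 0) / c)
  have hmem : y ∈ Set.uIcc (g m) (g n) := by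
    rw [hz, hz]
    rcases lt_or_gt_of_ne hc with h0 | h0
    · rw [lt_div_iff_of_neg h0] at hm
      rw [div_lt_iff_of_neg h0] at hn
      exact Set.mem_uIcc.2 (Or.inr ⟨by linarith, by linarith⟩)
    · rw [lt_div_iff₀ h0] at hm
      rw [div_lt_iff₀ h0] at hn
      exact Set.mem_uIcc.2 (Or.inl ⟨by linarith, by linarith⟩)
  obtain ⟨s, -, hs⟩ := intermediate_value_uIcc hg.continuousOn hmem
  exact ⟨s, hs⟩

/-- The height above a loop which is transversal to `v`, measured in the direction `v`. -/
lemma SimpleLoop.exists_height {Λ : Submodule ℤ ℂ} (R : SimpleLoop Λ) {v : ℂ} (hv : v ≠ 0)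
    (h : Function.Injective fun s => planeCross v (R.lift s)) :
    ∃ F : ℂ → ℝ, Continuous F ∧ (∀ (z : ℂ) (t : ℝ), F (z + t • v) = F z + t) ∧
      ∀ z, F z = 0 ↔ ∃ s, z = R.lift s := by
  have hc : Continuous fun s => planeCross v (R.lift s) :=
    (continuous_planeCross v).comp R.continuous_lift
  have hs := surjective_of_map_add_one (c := planeCross v R.period) hc h fun s => by
    rw [R.lift_add_one, planeCross_add]
  obtain ⟨σ, hσ, hinv⟩ := exists_continuous_rightInverse hc h hs
  have hl := R.continuous_lift
  have hp := continuous_planeCross v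
  -- `σ` picks the unique rim point on the line through `z` parallel to `v`; the height is the
  -- multiple of `v` leading from it to `z`.
  refine ⟨fun z => ((z - R.lift (σ (planeCross v z))) / v).re, by fun_prop, fun z t => ?_,
    fun z => ⟨fun hz => ⟨σ (planeCross v z), ?_⟩, ?_⟩⟩
  · beta_reduce
    rw [planeCross_add, planeCross_smul_self, add_zero, add_sub_right_comm, add_div, add_re,
      real_smul, mul_div_cancel_right₀ _ hv, ofReal_re]
  · have h0 : planeCross v (z - R.lift (σ (planeCross v z))) = 0 := by
      rw [planeCross_sub, sub_eq_zero]
      exact (hinv _).symm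
    have := eq_re_div_smul_of_planeCross_eq_zero hv h0
    beta_reduce at hz
    rw [hz, zero_smul, sub_eq_zero] at this
    exact this
  · rintro ⟨s, rfl⟩
    have : σ (planeCross v (R.lift s)) = s := h (hinv _)
    simp [this]

lemma pos_on_segment {G : ℂ → ℝ} (hG : Continuous G) {a b : ℂ}
    (h : ∀ x ∈ segment ℝ a b, G x ≠ 0) {y : ℂ} (hy : y ∈ segment ℝ a b) (hpos : 0 < G y) :
    ∀ x ∈ segment ℝ a b, 0 < G x := by
  intro x hx
  by_contra! hle
  obtain ⟨w, hw, hw0⟩ := (convex_segment a b).isPreconnected.intermediate_value hx hy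
    hG.continuousOn ⟨hle, hpos.le⟩
  exact h w hw hw0

/-! ### Lifting directed paths to the plane -/

namespace FlatPerfectNetwork

variable {Λ : Submodule ℤ ℂ} {V E : Type*} (N : FlatPerfectNetwork Λ V E)

lemma mem_segment_add {a d x : ℂ} :
    x ∈ segment ℝ a (a + d) ↔ ∃ t : ℝ, 0 ≤ t ∧ t ≤ 1 ∧ a + t • d = x := by
  rw [segment_eq_image']
  simp only [add_sub_cancel_left, Set.mem_image, Set.mem_Icc, and_assoc]

lemma vec_ne_zero (e : E) : N.vec e ≠ 0 := by
  intro h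
  have := (N.embedded e e (1 / 2) 0 (by norm_num) (by norm_num) le_rfl zero_le_one
    (by simp [h])).2
  norm_num at this

/-- Successive edges cannot double back, because they would overlap near their common vertex. This
excludes turning angles of π. -/
lemma zero_notMem_segment_vec {e f : E} (h : N.tgt e = N.src f) :
    (0 : ℂ) ∉ segment ℝ (N.vec e) (N.vec f) := by
  rintro ⟨α, β, hα, hβ, hab, h0⟩
  have hα' : α ≠ 0 := by
    rintro rfl
    obtain rfl : β = 1 := by linarith
    exact N.vec_ne_zero f (by simpa using h0)
  have hα'' := lt_of_le_of_ne hα hα'.symm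
  -- A common point of `e` and `f`; `embedded` would force 1 - α/2 = β/2, contrary to α + β = 1.
  have key : (1 - α / 2) • N.vec e = N.vec e + (β / 2) • N.vec f := by
    simp only [real_smul] at h0 ⊢
    push_cast
    linear_combination (-1 / 2 : ℂ) * h0
  have := (N.embedded e f (1 - α / 2) (β / 2) (by linarith) (by linarith) (by linarith)
    (by linarith) (by rw [key, map_add, ← add_assoc, ← N.pos_tgt, h])).2
  linarith

/-- Lifts of two edges to the plane are disjoint if their end-points are distinct. -/
lemma disjoint_segment {e f : E} {a a' b b' : ℂ} (ha : Λ.mkQ a = N.pos (N.src e))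
    (hb : Λ.mkQ b = N.pos (N.src f)) (ha' : a' = a + N.vec e) (hb' : b' = b + N.vec f)
    (h1 : a ≠ b) (h2 : a ≠ b') (h3 : a' ≠ b) (h4 : a' ≠ b') :
    Disjoint (segment ℝ a a') (segment ℝ b b') := by
  subst ha' hb'
  rw [Set.disjoint_left]
  intro x hx hx'
  obtain ⟨t, ht0, ht1, rfl⟩ := mem_segment_add.1 hx
  obtain ⟨u, hu0, hu1, h⟩ := mem_segment_add.1 hx'
  have hq : N.pos (N.src e) + Λ.mkQ (t • N.vec e) = N.pos (N.src f) + Λ.mkQ (u • N.vec f) := by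
    rw [← ha, ← hb, ← map_add, ← map_add, h]
  rcases ht0.eq_or_lt with rfl | ht0
  · rcases hu0.eq_or_lt with rfl | hu0
    · exact h1 (by simpa using h.symm)
    rcases hu1.eq_or_lt with rfl | hu1
    · exact h2 (by simpa using h.symm)
    · exact hu0.ne' (N.embedded f e u 0 hu0 hu1 le_rfl ht1 hq.symm).2
  rcases ht1.eq_or_lt with rfl | ht1
  · rcases hu0.eq_or_lt with rfl | hu0
    · exact h3 (by simpa using h.symm)
    rcases hu1.eq_or_lt with rfl | hu1
    · exact h4 (by simpa using h.symm)
    · exact hu1.ne (N.embedded f e u 1 hu0 hu1 zero_le_one le_rfl hq.symm).2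
  -- A point interior to both lifts forces the same edge and parameter, hence the same starting
  -- point.
  · obtain ⟨rfl, rfl⟩ := N.embedded e f t u ht0 ht1 hu0 hu1 hq
    exact h1 (add_right_cancel h.symm)

@[simp] lemma displacement_nil : N.displacement [] = 0 := rfl

@[simp] lemma displacement_cons (e : E) (l : List E) :
    N.displacement (e :: l) = N.vec e + N.displacement l := by
  simp [displacement]

@[simp] lemma displacement_append (l l' : List E) :
    N.displacement (l ++ l') = N.displacement l + N.displacement l' := by
  simp [displacement]

lemma displacement_take_succ (l : List E) {i : ℕ} (hi : i < l.length) :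
    N.displacement (l.take (i + 1)) = N.displacement (l.take i) + N.vec l[i] := by
  rw [List.take_succ_eq_append_getElem hi, displacement_append, displacement_cons,
    displacement_nil, add_zero]

/-- The sum of the signed angles between consecutive edges. -/
def angleSum : List E → ℝ
  | [] => 0
  | [_] => 0
  | a :: b :: l => signedAngle (N.vec a) (N.vec b) + angleSum (b :: l)

lemma angleSum_append {l l' : List E} (hl : l ≠ []) (hl' : l' ≠ []) :
    N.angleSum (l ++ l') = N.angleSum l +
      signedAngle (N.vec (l.getLast hl)) (N.vec (l'.head hl')) + N.angleSum l' := by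
  induction l with
  | nil => exact absurd rfl hl
  | cons a t ih =>
    cases t with
    | nil =>
      cases l' with
      | nil => exact absurd rfl hl'
      | cons b s => simp [angleSum]
    | cons c s =>
      have := ih (by simp)
      simp only [List.cons_append, angleSum] at this ⊢
      rw [this, List.getLast_cons (List.cons_ne_nil c s)]
      ring

/-- The lift to the plane of the `i`-th vertex of a directed path whose first vertex is lifted
to `a`. -/
def liftVertex (a : ℂ) (l : List E) (i : ℕ) : ℂ := a + N.displacement (l.take i)

@[simp] lemma liftVertex_zero (a : ℂ) (l : List E) : N.liftVertex a l 0 = a := by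
  simp [liftVertex]

lemma liftVertex_succ (a : ℂ) (l : List E) {i : ℕ} (hi : i < l.length) :
    N.liftVertex a l (i + 1) = N.liftVertex a l i + N.vec l[i] := by
  rw [liftVertex, liftVertex, N.displacement_take_succ l hi, add_assoc]

lemma liftVertex_succ_sub (a : ℂ) (l : List E) {i : ℕ} (hi : i < l.length) :
    N.liftVertex a l (i + 1) - N.liftVertex a l i = N.vec l[i] := by
  rw [N.liftVertex_succ a l hi, add_sub_cancel_left]

lemma liftVertex_length (a : ℂ) (l : List E) :
    N.liftVertex a l l.length = a + N.displacement l := by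
  rw [liftVertex, List.take_length]

lemma angleSum_eq_sum (a : ℂ) (l : List E) (n : ℕ) (hn : l.length = n + 1) :
    N.angleSum l = ∑ i ∈ range n,
      arg ((N.liftVertex a l (i + 2) - N.liftVertex a l (i + 1)) /
        (N.liftVertex a l (i + 1) - N.liftVertex a l i)) := by
  induction l generalizing n a with
  | nil => simp at hn
  | cons e t ih =>
    cases t with
    | nil =>
      obtain rfl : n = 0 := by simpa using hn.symm
      simp [angleSum]
    | cons f s =>
      obtain ⟨m, rfl⟩ : ∃ m, n = m + 1 := ⟨s.length, by simpa using hn.symm⟩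
      have hshift : ∀ i, N.liftVertex a (e :: f :: s) (i + 1) =
          N.liftVertex (a + N.vec e) (f :: s) i := fun i => by
        simp [liftVertex, add_assoc]
      rw [sum_range_succ', angleSum, ih (a + N.vec e) m (by simpa using hn), add_comm]
      congr 1
      · refine sum_congr rfl fun i _ => ?_
        rw [hshift, hshift, hshift]
      · rw [N.liftVertex_succ_sub _ _ (by simp), N.liftVertex_succ_sub _ _ (by simp)]
        rfl

lemma mkQ_liftVertex {a : ℂ} {l : List E} (hl : l.IsChain fun e f => N.tgt e = N.src f)
    (ha : ∀ h : 0 < l.length, Λ.mkQ a = N.pos (N.src l[0])) {i : ℕ} (hi : i < l.length) :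
    Λ.mkQ (N.liftVertex a l i) = N.pos (N.src l[i]) := by
  induction i with
  | zero => rw [liftVertex_zero, ha hi]
  | succ i ih =>
    rw [N.liftVertex_succ a l (by omega), map_add, ih (by omega), ← N.pos_tgt,
      List.isChain_iff_getElem.1 hl i hi]

lemma mkQ_liftVertex_succ {a : ℂ} {l : List E} (hl : l.IsChain fun e f => N.tgt e = N.src f)
    (ha : ∀ h : 0 < l.length, Λ.mkQ a = N.pos (N.src l[0])) {i : ℕ} (hi : i < l.length) :
    Λ.mkQ (N.liftVertex a l (i + 1)) = N.pos (N.tgt l[i]) := by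
  rw [N.liftVertex_succ a l hi, map_add, N.mkQ_liftVertex hl ha hi, ← N.pos_tgt]

lemma exists_mkQ_eq_pos (l : List E) :
    ∃ a : ℂ, ∀ h : 0 < l.length, Λ.mkQ a = N.pos (N.src l[0]) := by
  by_cases h : 0 < l.length
  · obtain ⟨a, ha⟩ := Λ.mkQ_surjective (N.pos (N.src l[0]))
    exact ⟨a, fun _ => ha⟩
  · exact ⟨0, fun h' => absurd h' h⟩

lemma zero_notMem_segment_liftVertex (a : ℂ) {l : List E}
    (hl : l.IsChain fun e f => N.tgt e = N.src f) {i : ℕ} (hi : i + 1 < l.length) :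
    (0 : ℂ) ∉ segment ℝ (N.liftVertex a l (i + 1) - N.liftVertex a l i)
      (N.liftVertex a l (i + 2) - N.liftVertex a l (i + 1)) := by
  rw [N.liftVertex_succ_sub a l (by omega), N.liftVertex_succ_sub a l hi]
  exact N.zero_notMem_segment_vec (List.isChain_iff_getElem.1 hl i hi)

/-- A closed directed path on the universal covering is closed on the torus. -/
lemma tgt_getLast_eq_src_head {l : List E} (hl : l.IsChain fun e f => N.tgt e = N.src f)
    (h0 : l ≠ []) (hd : N.displacement l = 0) :
    N.tgt (l.getLast h0) = N.src (l.head h0) := by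
  obtain ⟨a, ha⟩ := N.exists_mkQ_eq_pos l
  have hlen : 0 < l.length := List.length_pos_iff.2 h0
  apply N.pos_injective
  have h := N.mkQ_liftVertex_succ hl ha (i := l.length - 1) (by omega)
  rw [Nat.sub_add_cancel hlen, N.liftVertex_length, hd, add_zero, ha hlen] at h
  rw [List.getLast_eq_getElem, List.head_eq_getElem, ← h]

/-- The turning numbers along a contractible simple cycle. -/
lemma exp_half_angleSum_cycle {l : List E} (hl : l.IsChain fun e f => N.tgt e = N.src f)
    (h : N.IsContractibleSimpleCycle l) :
    exp (I / 2 * ((N.angleSum l +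
      signedAngle (N.vec (l.getLast h.1)) (N.vec (l.head h.1)) : ℝ) : ℂ)) = -1 := by
  obtain ⟨h0, hd, hs⟩ := h
  have hclose := N.tgt_getLast_eq_src_head hl h0 hd
  obtain ⟨a, ha⟩ := N.exists_mkQ_eq_pos l
  have hpos : 0 < l.length := List.length_pos_iff.2 h0
  -- One edge has nonzero displacement, and two edges closing up would double back.
  obtain ⟨n, hn⟩ : ∃ n, l.length = n + 3 := by
    match l, h0, hd, hl, hclose with
    | [e], _, hd, _, _ => exact absurd (by simpa using hd) (N.vec_ne_zero e)
    | [e, f], _, hd, hl, _ =>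
      refine absurd ⟨1 / 2, 1 / 2, by norm_num, by norm_num, by norm_num, ?_⟩
        (N.zero_notMem_segment_vec (e := e) (f := f) (by simpa using hl))
      rw [← smul_add, show N.vec e + N.vec f = 0 by simpa using hd, smul_zero]
    | _ :: _ :: _ :: t, _, _, _, _ => exact ⟨t.length, rfl⟩
  set z := N.liftVertex a l with hz
  have hz3 : z (n + 3) = z 0 := by
    rw [hz, ← hn, N.liftVertex_length, hd, liftVertex_zero, add_zero]
  have hinj : ∀ i j, i < j → j < n + 3 → z i ≠ z j := fun i j hij hj h' =>
    hs i j hij (by omega) (add_left_cancel h')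
  have hinj' : ∀ i j, i < j → j ≤ n + 3 → (i ≠ 0 ∨ j ≠ n + 3) → z i ≠ z j := by
    intro i j hij hj h'
    rcases hj.eq_or_lt with rfl | hj
    · rw [hz3]
      exact (hinj 0 i (by omega) (by omega)).symm
    · exact hinj i j hij hj
  have hvec : ∀ {i} (hi : i < l.length), z (i + 1) = z i + N.vec l[i] := fun hi =>
    N.liftVertex_succ a l hi
  have hlast : l.getLast h0 = l[n + 2]'(by omega) := by
    rw [List.getLast_eq_getElem]
    congr 1
    omega
  have hvlast : z (n + 3) - z (n + 2) = N.vec (l.getLast h0) := by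
    rw [hlast]; exact N.liftVertex_succ_sub a l (by omega)
  have hvhead : z 1 - z 0 = N.vec (l.head h0) := by
    rw [List.head_eq_getElem]; exact N.liftVertex_succ_sub a l hpos
  have := exp_half_turning_of_closed z n hz3
    (fun i j hij hj hne => by
      have hne' : i ≠ 0 ∨ j ≠ n + 2 := by
        by_contra! hcon
        exact hne (by rw [hcon.1, hcon.2])
      exact N.disjoint_segment (N.mkQ_liftVertex hl ha (by omega))
        (N.mkQ_liftVertex hl ha (by omega)) (hvec (by omega)) (hvec (by omega))
        (hinj' i j (by omega) (by omega) (by omega))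
        (hinj' i (j + 1) (by omega) (by omega) (by omega))
        (hinj' (i + 1) j (by omega) (by omega) (by omega))
        (hinj' (i + 1) (j + 1) (by omega) (by omega) (by omega)))
    (fun i hi => N.zero_notMem_segment_liftVertex a hl (by omega))
    (by rw [hvlast, hvhead]; exact N.zero_notMem_segment_vec hclose)
    (fun i hi hi' => (hinj 0 i hi hi').symm)
  rw [hvlast, hvhead, ← N.angleSum_eq_sum a l (n + 2) hn] at this
  exact this

end FlatPerfectNetwork

/-! ### Turning numbers and the removal of cycles -/

namespace FlatPerfectNetwork

variable {Λ : Submodule ℤ ℂ} {V E : Type*} (N : FlatPerfectNetwork Λ V E)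

open Classical in
/-- The contribution of an edge to the product of turning numbers. -/
def edgeTurn (e : E) : ℂ := if h : N.color (N.src e) = VertexColor.white then N.turn e h else 1

lemma edgeTurn_of_black {e : E} (h : N.color (N.src e) = VertexColor.black) :
    N.edgeTurn e = 1 := by
  rw [edgeTurn, dif_neg]
  simp [h]

lemma edgeTurn_of_white {e f g : E} (h : N.color (N.src f) = VertexColor.white)
    (he : N.tgt e = N.src f) (hg : N.tgt f = N.src g) :
    N.edgeTurn f = exp (I / 2 *
      ((signedAngle (N.vec e) (N.vec f) + signedAngle (N.vec f) (N.vec g) : ℝ) : ℂ)) := by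
  have h1 : N.predEdge f h = e :=
    (N.white_in (N.src f) h).unique (N.white_in (N.src f) h).choose_spec.1 he
  have hb := N.black_out (N.tgt f) (N.color_tgt_of_white h)
  have h2 : N.succEdge f h = g := hb.unique hb.choose_spec.1 hg.symm
  rw [edgeTurn, dif_pos h, turn, h1, h2]

lemma color_tgt_of_black {e : E} (h : N.color (N.src e) = VertexColor.black) :
    N.color (N.tgt e) = VertexColor.white := by
  have hb := N.bipartite e
  cases ht : N.color (N.tgt e)
  · rfl
  · exact absurd (h.trans ht.symm) hb

/-- The induction removes two edges at a time: the white-to-black edge `f` accounts for both angles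
adjacent to it. -/
lemma prod_edgeTurn (e : E) (l : List E)
    (hl : (e :: l).IsChain fun e f => N.tgt e = N.src f)
    (he : N.color (N.src e) = VertexColor.black)
    (hlast : N.color (N.src ((e :: l).getLast (List.cons_ne_nil e l))) = VertexColor.black) :
    ((e :: l).map N.edgeTurn).prod = exp (I / 2 * (N.angleSum (e :: l) : ℂ)) := by
  match l with
  | [] => simp [angleSum, N.edgeTurn_of_black he]
  | [f] =>
    have hf : N.tgt e = N.src f := by simpa using hl
    have := N.color_tgt_of_black he
    rw [hf] at this
    simp [this] at hlast
  | f :: g :: t =>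
    obtain ⟨hef, hl⟩ := List.isChain_cons_cons.1 hl
    obtain ⟨hfg, hl⟩ := List.isChain_cons_cons.1 hl
    have hf : N.color (N.src f) = VertexColor.white := hef ▸ N.color_tgt_of_black he
    have hg : N.color (N.src g) = VertexColor.black := hfg ▸ N.color_tgt_of_white hf
    have ih := prod_edgeTurn g t hl hg (by
      rwa [List.getLast_cons (List.cons_ne_nil _ _), List.getLast_cons (List.cons_ne_nil _ _)]
        at hlast)
    rw [List.map_cons, List.map_cons, List.prod_cons, List.prod_cons, ih,
      N.edgeTurn_of_black he, N.edgeTurn_of_white hf hef hfg, one_mul, ← exp_add]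
    congr 1
    simp only [angleSum]
    push_cast
    ring
termination_by l.length

namespace CylinderPath

variable {N} {R : SimpleLoop Λ}

/-- All edges of a path. -/
def edges (γ : N.CylinderPath R) : List E := γ.source :: (γ.mid ++ [γ.sink])

lemma turnProduct_eq {v : ℂ} (hN : N.IsNormalized R v) (γ : N.CylinderPath R) :
    γ.turnProduct = exp (I / 2 * (N.angleSum γ.edges : ℂ)) := by
  refine Eq.trans ?_ (N.prod_edgeTurn γ.source (γ.mid ++ [γ.sink]) γ.chain
    (hN.black_to_white _ γ.source_crosses) ?_)
  · rfl
  · rw [List.getLast_cons (by simp), List.getLast_append_singleton]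
    exact hN.black_to_white _ γ.sink_crosses

end CylinderPath

lemma exp_half_angleSum_insert {l c l' : List E} (hl : l ≠ []) (hl' : l' ≠ [])
    (hch : (l ++ c ++ l').IsChain fun e f => N.tgt e = N.src f)
    (hc : N.IsContractibleSimpleCycle c) :
    exp (I / 2 * (N.angleSum (l ++ c ++ l') : ℂ)) =
      -exp (I / 2 * (N.angleSum (l ++ l') : ℂ)) := by
  have hc0 := hc.1
  obtain ⟨h1, -, h2⟩ := List.isChain_append.1 hch
  obtain ⟨-, hcc, h3⟩ := List.isChain_append.1 h1
  have hin : N.tgt (l.getLast hl) = N.src (c.head hc0) :=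
    h3 _ (by rw [List.getLast?_eq_some_getLast hl]; rfl) _
      (by rw [List.head?_eq_some_head hc0]; rfl)
  have hout : N.tgt (c.getLast hc0) = N.src (l'.head hl') :=
    h2 _ (by rw [List.getLast?_append_of_ne_nil _ hc0, List.getLast?_eq_some_getLast hc0]; rfl) _
      (by rw [List.head?_eq_some_head hl']; rfl)
  have hclose := N.tgt_getLast_eq_src_head hcc hc0 hc.2.1
  have hcycle := N.exp_half_angleSum_cycle hcc hc
  have hsum : N.angleSum (l ++ c ++ l') = N.angleSum (l ++ l') + (N.angleSum c +
      signedAngle (N.vec (c.getLast hc0)) (N.vec (c.head hc0))) := by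
    rw [N.angleSum_append (by simp [hl]) hl', N.angleSum_append hl hc0,
      N.angleSum_append hl hl', List.getLast_append_of_ne_nil _ hc0]
    -- At a white base vertex the last edges of `l` and `c` coincide; at a black one the first edges
    -- of `c` and `l'` do. Either way the junction angles rearrange.
    cases hcol : N.color (N.src (c.head hc0))
    · rw [(N.white_in _ hcol).unique hin hclose]
      ring
    · rw [(N.black_out _ hcol).unique rfl (hout.symm.trans hclose)]
      ring
  rw [hsum, ofReal_add, mul_add, exp_add, hcycle, mul_neg_one]

namespace CylinderPath

variable {N} {R : SimpleLoop Λ}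

lemma turnProduct_of_decomposesInto {v : ℂ} (hN : N.IsNormalized R v)
    {γ γ' : N.CylinderPath R} (h : γ.DecomposesInto γ') :
    γ.turnProduct = -γ'.turnProduct := by
  obtain ⟨hs, ht, a, c, b, hm, hm', hc⟩ := h
  have h1 : γ.edges = (γ.source :: a) ++ c ++ (b ++ [γ.sink]) := by simp [edges, hm]
  have h2 : γ'.edges = (γ.source :: a) ++ (b ++ [γ.sink]) := by simp [edges, hm', hs, ht]
  rw [turnProduct_eq hN, turnProduct_eq hN, h1, h2]
  exact N.exp_half_angleSum_insert (by simp) (by simp) (h1 ▸ γ.chain) hc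

lemma exists_decomposesInto {γ : N.CylinderPath R} (h : ¬ γ.IsSimple) :
    ∃ γ' : N.CylinderPath R, γ.DecomposesInto γ' ∧ γ'.mid.length < γ.mid.length := by
  classical
  have hex : ∃ j, ∃ i < j, j ≤ γ.mid.length ∧
      N.displacement (γ.mid.take i) = N.displacement (γ.mid.take j) := by
    unfold IsSimple at h
    push Not at h
    obtain ⟨i, j, hij, hj, h⟩ := h
    exact ⟨j, i, hij, hj, h⟩
  -- The least `j` at which the lift revisits a vertex: by minimality the loop closed at `j` is
  -- simple.
  set j := Nat.find hex with hjdef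
  obtain ⟨i, hij, hj, hd⟩ := Nat.find_spec hex
  rw [← hjdef] at hij hj hd
  set c := (γ.mid.take j).drop i with hcdef
  have hclen : c.length = j - i := by simp [hcdef, hj]
  have htake : ∀ k ≤ j - i, γ.mid.take (i + k) = γ.mid.take i ++ c.take k := by
    intro k hk
    rw [hcdef, List.take_add, List.drop_take, List.take_take, min_eq_left hk]
  have hsplit : γ.mid = γ.mid.take i ++ c ++ γ.mid.drop j := by
    have := htake (j - i) le_rfl
    rw [Nat.add_sub_cancel' hij.le, List.take_of_length_le hclen.le] at this
    rw [← this, List.take_append_drop]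
  have hc : N.IsContractibleSimpleCycle c := by
    refine ⟨fun h0 => ?_, ?_, fun k m hkm hm he => ?_⟩
    · rw [h0, List.length_nil] at hclen
      omega
    · have := htake (j - i) le_rfl
      rw [Nat.add_sub_cancel' hij.le, List.take_of_length_le hclen.le] at this
      rw [this, displacement_append] at hd
      exact left_eq_add.1 hd
    · refine Nat.find_min hex (m := i + m) (by omega) ⟨i + k, by omega, by omega, ?_⟩
      rw [htake k (by omega), htake m (by omega), displacement_append, displacement_append, he]
  have hedges : (γ.source :: γ.mid.take i) ++ c ++ (γ.mid.drop j ++ [γ.sink]) =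
      γ.source :: (γ.mid ++ [γ.sink]) := by
    conv_rhs => rw [hsplit]
    simp
  have hch := γ.chain
  rw [← hedges] at hch
  obtain ⟨h1, h4, h2⟩ := List.isChain_append.1 hch
  obtain ⟨h5, hcc, h3⟩ := List.isChain_append.1 h1
  have hc0 := hc.1
  have hclose := N.tgt_getLast_eq_src_head hcc hc0 hc.2.1
  refine ⟨⟨γ.source, γ.mid.take i ++ γ.mid.drop j, γ.sink, γ.source_crosses, γ.sink_crosses,
    fun e he => γ.mid_not_crosses e ?_, ?_⟩, ⟨rfl, rfl, _, c, _, hsplit, rfl, hc⟩, ?_⟩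
  · rcases List.mem_append.1 he with he | he
    · exact List.mem_of_mem_take he
    · exact List.mem_of_mem_drop he
  · rw [List.append_assoc, ← List.cons_append]
    refine List.isChain_append.2 ⟨h5, h4, fun x hx y hy => ?_⟩
    have hin := h3 x hx _ (by rw [List.head?_eq_some_head hc0]; rfl)
    have hout := h2 _ (by
      rw [List.getLast?_append_of_ne_nil _ hc0, List.getLast?_eq_some_getLast hc0]; rfl) y hy
    rw [hin, ← hclose, hout]
  · simp only [List.length_append, List.length_take, List.length_drop]
    omega

lemma exists_hasSign (γ : N.CylinderPath R) : ∃ ε, HasSign γ ε := by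
  induction hn : γ.mid.length using Nat.strong_induction_on generalizing γ with
  | _ n ih =>
    by_cases h : γ.IsSimple
    · exact ⟨1, HasSign.simple γ h⟩
    · obtain ⟨γ', hd, hlt⟩ := exists_decomposesInto h
      obtain ⟨ε, hε⟩ := ih _ (hn ▸ hlt) γ' rfl
      exact ⟨-ε, HasSign.cycle γ γ' ε hd hε⟩

/-! ### Simple paths between source and sink -/

/-- The total turning of a simple path from a source to a sink vanishes. -/
lemma angleSum_edges_of_isSimple {v : ℂ} (hN : N.IsNormalized R v) {γ : N.CylinderPath R}
    (h : γ.IsSimple) : N.angleSum γ.edges = 0 := by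
  obtain ⟨c₀, hc₀, hsource⟩ := hN.parallel _ γ.source_crosses
  obtain ⟨c₁, hc₁, hsink⟩ := hN.parallel _ γ.sink_crosses
  have hv : v ≠ 0 := by
    rintro rfl
    exact N.vec_ne_zero γ.source (by rw [hsource, smul_zero])
  obtain ⟨F, hF, hFadd, hF0⟩ := R.exists_height hv hN.transversal
  obtain ⟨a, ha⟩ := N.exists_mkQ_eq_pos γ.edges
  set k := γ.mid.length with hk
  have hlen : γ.edges.length = k + 2 := by simp [edges, hk]
  have hchain : γ.edges.IsChain fun e f => N.tgt e = N.src f := γ.chain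
  set z := N.liftVertex a γ.edges with hz
  have hvec : ∀ {i} (hi : i < γ.edges.length), z (i + 1) = z i + N.vec γ.edges[i] := fun hi =>
    N.liftVertex_succ a γ.edges hi
  have hpos : ∀ {i} (hi : i < γ.edges.length), Λ.mkQ (z i) = N.pos (N.src γ.edges[i]) :=
    fun hi => N.mkQ_liftVertex hchain ha hi
  have hpos' : ∀ {i} (hi : i < γ.edges.length), Λ.mkQ (z (i + 1)) = N.pos (N.tgt γ.edges[i]) :=
    fun hi => N.mkQ_liftVertex_succ hchain ha hi
  have he0 : γ.edges[0] = γ.source := rfl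
  have hek : γ.edges[k + 1]'(by omega) = γ.sink := by simp [edges, hk]
  have hz1 : z 1 = z 0 + c₀ • v := by
    rw [hvec (i := 0) (by omega), he0, hsource]
  have hzk : z (k + 2) = z (k + 1) + c₁ • v := by
    rw [hvec (i := k + 1) (by omega), hek, hsink]
  obtain ⟨t₀, ht₀, ht₀', s₀, hs₀⟩ := γ.source_crosses
  obtain ⟨t₁, ht₁, ht₁', s₁, hs₁⟩ := γ.sink_crosses
  have hmkQ : ∀ l ∈ Λ, Λ.mkQ l = 0 := fun l hl => (Submodule.Quotient.mk_eq_zero Λ).2 hl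
  have hoff : ∀ (x : ℂ) (p : V), Λ.mkQ x = N.pos p → ∀ l ∈ Λ, F (x - l) ≠ 0 := by
    intro x p hx l hl h0
    obtain ⟨s, hs⟩ := (hF0 _).1 h0
    refine hN.vertices_off_rim p s ?_
    rw [← hx, ← hs, map_sub, hmkQ l hl, sub_zero]
  have hmid : ∀ i, 1 ≤ i → i ≤ k → ∀ x ∈ segment ℝ (z i) (z (i + 1)), ∀ l ∈ Λ,
      F (x - l) ≠ 0 := by
    intro i hi hik x hx l hl h0
    have hmem : γ.edges[i]'(by omega) ∈ γ.mid := by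
      obtain ⟨j, rfl⟩ : ∃ j, i = j + 1 := ⟨i - 1, by omega⟩
      have : γ.edges[j + 1]'(by omega) = γ.mid[j]'(by omega) := by
        simp [edges, List.getElem_append_left (show j < γ.mid.length by omega)]
      rw [this]
      exact List.getElem_mem _
    rw [hvec (by omega)] at hx
    obtain ⟨t, ht, ht', rfl⟩ := mem_segment_add.1 hx
    obtain ⟨s, hs⟩ := (hF0 _).1 h0
    refine γ.mid_not_crosses _ hmem ⟨t, ht, ht', s, ?_⟩
    rw [← hpos, ← map_add, ← hs, map_sub, hmkQ l hl, sub_zero]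
  -- The crossing point and its rim point differ by a lattice vector; relative to the rim translated
  -- by it, the edge starts at height -(tc).
  have hrim : ∀ (x : ℂ) (e : E) (t c s : ℝ), Λ.mkQ x = N.pos (N.src e) → N.vec e = c • v →
      N.pos (N.src e) + Λ.mkQ (t • N.vec e) = Λ.mkQ (R.lift s) →
      ∃ l ∈ Λ, F (x - l) = -(t * c) := by
    intro x e t c s hx he hs
    refine ⟨x + t • N.vec e - R.lift s, (Submodule.Quotient.mk_eq_zero Λ).1 ?_, ?_⟩
    · change Λ.mkQ _ = 0
      rw [map_sub, map_add, hx, hs, sub_self]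
    · have := (hF0 (R.lift s)).2 ⟨s, rfl⟩
      rw [show R.lift s = (x - (x + t • N.vec e - R.lift s)) + (t * c) • v by
        rw [he, smul_smul]; ring, hFadd] at this
      linarith
  -- `l₀` and `l₁` translate the rim to the lifts which are crossed by the first and last edge
  obtain ⟨l₀, hl₀, hl₀'⟩ :=
    hrim (z 0) γ.source t₀ c₀ s₀ (hpos (i := 0) (by omega)) hsource hs₀
  obtain ⟨l₁, hl₁, hl₁'⟩ :=
    hrim (z (k + 1)) γ.sink t₁ c₁ s₁ (by rw [hpos (i := k + 1) (by omega), hek]) hsink hs₁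
  set G₀ : ℂ → ℝ := fun x => F (x - l₀) with hG₀
  set G₁ : ℂ → ℝ := fun x => F (x - l₁) with hG₁
  have hG₀c : Continuous G₀ := by fun_prop
  have hG₁c : Continuous G₁ := by fun_prop
  have hG₀add : ∀ (x : ℂ) (t : ℝ), G₀ (x + t • v) = G₀ x + t := fun x t => by
    rw [hG₀]; beta_reduce; rw [add_sub_right_comm, hFadd]
  have hG₁add : ∀ (x : ℂ) (t : ℝ), G₁ (x + t • v) = G₁ x + t := fun x t => by
    rw [hG₁]; beta_reduce; rw [add_sub_right_comm, hFadd]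
  have hsrc₀ : G₀ (z 0) < 0 :=
    lt_of_le_of_ne (by rw [hG₀]; beta_reduce; rw [hl₀']; nlinarith)
      (hoff _ _ (hpos (i := 0) (by omega)) _ hl₀)
  have htgt₀ : 0 < G₀ (z 1) := by
    refine lt_of_le_of_ne ?_ (hoff _ _ (hpos' (i := 0) (by omega)) _ hl₀).symm
    rw [hz1, hG₀add, hG₀]; beta_reduce; rw [hl₀']; nlinarith
  have hsrc₁ : G₁ (z (k + 1)) < 0 :=
    lt_of_le_of_ne (by rw [hG₁]; beta_reduce; rw [hl₁']; nlinarith)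
      (hoff _ _ (hpos (i := k + 1) (by omega)) _ hl₁)
  have htgt₁ : 0 < G₁ (z (k + 2)) := by
    refine lt_of_le_of_ne ?_ (hoff _ _ (hpos' (i := k + 1) (by omega)) _ hl₁).symm
    rw [hzk, hG₁add, hG₁]; beta_reduce; rw [hl₁']; nlinarith
  -- After the first crossing the path stays above the translate by `l₀`: middle edges avoid every
  -- lift of the rim, and the last edge only rises.
  have hV₀ : ∀ i, 1 ≤ i → i ≤ k + 1 → 0 < G₀ (z i) := by
    intro i hi
    induction i, hi using Nat.le_induction with
    | base => exact fun _ => htgt₀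
    | succ i hi ih =>
      intro hik
      exact pos_on_segment hG₀c (fun x hx => hmid i hi (by omega) x hx l₀ hl₀)
        (left_mem_segment ℝ _ _) (ih (by omega)) _ (right_mem_segment ℝ _ _)
  have hS₀ : ∀ i, 1 ≤ i → i ≤ k + 1 → ∀ x ∈ segment ℝ (z i) (z (i + 1)), 0 < G₀ x := by
    intro i hi hik x hx
    rcases hik.lt_or_eq with hik | rfl
    · exact pos_on_segment hG₀c (fun x hx => hmid i hi (by omega) x hx l₀ hl₀)
        (left_mem_segment ℝ _ _) (hV₀ i hi (by omega)) _ hx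
    · rw [show z (k + 1 + 1) = z (k + 1) + c₁ • v from hzk] at hx
      obtain ⟨t, ht, -, rfl⟩ := mem_segment_add.1 hx
      rw [smul_smul, hG₀add]
      have := hV₀ (k + 1) (by omega) le_rfl
      positivity
  -- Dually, going backwards from the last crossing, the path stays below the translate by `l₁`.
  have hV₁ : ∀ i, 1 ≤ i → i ≤ k + 1 → G₁ (z i) < 0 := by
    intro i hi hik
    induction hik using Nat.decreasingInduction with
    | self => exact hsrc₁
    | of_succ i hik ih =>
      exact neg_pos.1 (pos_on_segment hG₁c.neg
        (fun x hx => neg_ne_zero.2 (hmid i hi (by omega) x hx l₁ hl₁))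
        (right_mem_segment ℝ _ _) (neg_pos.2 (ih (by omega))) _ (left_mem_segment ℝ _ _))
  have hS₁ : ∀ i, i ≤ k → ∀ x ∈ segment ℝ (z i) (z (i + 1)), G₁ x < 0 := by
    intro i hik x hx
    rcases Nat.eq_zero_or_pos i with rfl | hi
    · have h1 := hV₁ 1 le_rfl (by omega)
      rw [hvec (by omega), he0, hsource] at hx
      obtain ⟨t, -, ht, rfl⟩ := mem_segment_add.1 hx
      rw [hz1, hG₁add] at h1
      rw [smul_smul, hG₁add]
      nlinarith
    · exact neg_pos.1 (pos_on_segment hG₁c.neg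
        (fun x hx => neg_ne_zero.2 (hmid i hi hik x hx l₁ hl₁))
        (left_mem_segment ℝ _ _) (neg_pos.2 (hV₁ i hi (by omega))) _ hx)
  -- `IsSimple` covers only the inner vertices; heights separate the two outer vertices from the
  -- rest.
  have hinj : ∀ i j, i < j → j ≤ k + 2 → z i ≠ z j := by
    intro i j hij hj hEq
    rcases Nat.eq_zero_or_pos i with rfl | hi
    · obtain ⟨m, rfl⟩ : ∃ m, j = m + 1 := ⟨j - 1, by omega⟩
      have : 0 < G₀ (z (m + 1)) := by
        rcases Nat.eq_zero_or_pos m with rfl | hm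
        · exact htgt₀
        · exact hS₀ m hm (by omega) _ (right_mem_segment ℝ _ _)
      rw [← hEq] at this
      exact lt_asymm this hsrc₀
    rcases hj.lt_or_eq with hj | rfl
    · have hmidz : ∀ m, m ≤ k →
          z (m + 1) = a + N.vec γ.source + N.displacement (γ.mid.take m) := by
        intro m hm
        simp [hz, liftVertex, edges, List.take_append_of_le_length (hk ▸ hm), add_assoc]
      obtain ⟨i, rfl⟩ : ∃ m, i = m + 1 := ⟨i - 1, by omega⟩
      obtain ⟨j, rfl⟩ : ∃ m, j = m + 1 := ⟨j - 1, by omega⟩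
      rw [hmidz i (by omega), hmidz j (by omega)] at hEq
      exact h i j (by omega) (by omega) (add_left_cancel hEq)
    · have := hV₁ i hi (by omega)
      rw [hEq] at this
      exact lt_asymm this htgt₁
  rw [N.angleSum_eq_sum a γ.edges (k + 1) hlen, sum_arg_turning_eq z (k + 1)
    (fun i j hij hj => N.disjoint_segment (hpos (by omega)) (hpos (by omega)) (hvec (by omega))
      (hvec (by omega)) (hinj _ _ (by omega) (by omega)) (hinj _ _ (by omega) (by omega))
      (hinj _ _ (by omega) (by omega)) (hinj _ _ (by omega) (by omega)))
    (fun i hi => N.zero_notMem_segment_liftVertex a hchain (by omega))]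
  have hslit : ∀ {x y : ℂ} (_ : ∀ t : ℝ, 0 ≤ t → y ≠ x + (-t) • v), (y - x) / v ∈ slitPlane := by
    intro x y hxy
    by_contra hcon
    rw [mem_slitPlane_iff, not_or, not_lt, not_not] at hcon
    refine hxy (-((y - x) / v).re) (by linarith) ?_
    have : (y - x) / v = (((y - x) / v).re : ℂ) :=
      Complex.ext (by simp) (by simpa using hcon.2)
    rw [neg_neg, real_smul, ← this, div_mul_cancel₀ _ hv]
    ring
  -- The ray from `z 0` in direction -v stays below the translate by `l₀`, so it misses the rest of
  -- the path. The argument relative to `v` thus has no jump.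
  have hsum₀ := sum_arg_div_of_segment_subset_slitPlane (fun j => (z (j + 1) - z 0) / v) (k + 1)
    (by
      intro i hi w hw
      obtain ⟨α, β, hα, hβ, hαβ, rfl⟩ := hw
      have hx : α • z (i + 1) + β • z (i + 1 + 1) ∈ segment ℝ (z (i + 1)) (z (i + 1 + 1)) :=
        ⟨α, β, hα, hβ, hαβ, rfl⟩
      have : α • ((z (i + 1) - z 0) / v) + β • ((z (i + 1 + 1) - z 0) / v) =
          (α • z (i + 1) + β • z (i + 1 + 1) - z 0) / v := by
        obtain rfl : β = 1 - α := by linarith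
        simp only [real_smul]
        push_cast
        ring
      rw [this]
      refine hslit fun t ht hcon => ?_
      have hg := hS₀ (i + 1) (by omega) (by omega) _ hx
      rw [hcon, hG₀add] at hg
      linarith)
  have hsum₁ := sum_arg_div_of_segment_subset_slitPlane (fun i => (z (k + 2) - z i) / v) (k + 1)
    (by
      intro i hi w hw
      obtain ⟨α, β, hα, hβ, hαβ, rfl⟩ := hw
      have hx : α • z i + β • z (i + 1) ∈ segment ℝ (z i) (z (i + 1)) :=
        ⟨α, β, hα, hβ, hαβ, rfl⟩
      have : α • ((z (k + 2) - z i) / v) + β • ((z (k + 2) - z (i + 1)) / v) =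
          (z (k + 2) - (α • z i + β • z (i + 1))) / v := by
        obtain rfl : β = 1 - α := by linarith
        simp only [real_smul]
        push_cast
        ring
      rw [this]
      refine hslit fun t ht hcon => ?_
      have hg := hS₁ i (by omega) _ hx
      rw [hcon, hG₁add] at htgt₁
      linarith)
  simp only [div_div_div_cancel_right₀ hv] at hsum₀ hsum₁
  have harg : ∀ c : ℝ, 0 < c → arg ((c • v) / v) = 0 := by
    intro c hc
    rw [real_smul, mul_div_cancel_right₀ _ hv, arg_ofReal_of_nonneg hc.le]
  have hfirst : z (0 + 1) - z 0 = c₀ • v := by rw [zero_add, hz1, add_sub_cancel_left]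
  have hlast : z (k + 2) - z (k + 1) = c₁ • v := by rw [hzk, add_sub_cancel_left]
  rw [hfirst, harg c₀ hc₀] at hsum₀
  rw [hlast, harg c₁ hc₁] at hsum₁
  have h₀ : ∑ j ∈ range (k + 1), arg ((z (j + 2) - z 0) / (z (j + 1) - z 0)) =
      arg ((z (k + 2) - z 0) / v) - 0 := hsum₀
  have h₁ : ∑ i ∈ range (k + 1), arg ((z (k + 2) - z (i + 1)) / (z (k + 2) - z i)) =
      0 - arg ((z (k + 2) - z 0) / v) := hsum₁
  -- The end edges point along `v`, so only the argument of the chord from first to last vertex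
  -- remains, once with each sign.
  rw [h₀]
  exact (congrArg _ h₁).trans (by ring)

end CylinderPath

lemma HasSign.coe_eq_turnProduct {R : SimpleLoop Λ} {v : ℂ} {N : FlatPerfectNetwork Λ V E}
    (hN : N.IsNormalized R v) {γ : N.CylinderPath R} {ε : ℤˣ} (h : HasSign γ ε) :
    ((ε : ℤ) : ℂ) = γ.turnProduct := by
  induction h with
  | simple γ h =>
    rw [CylinderPath.turnProduct_eq hN, CylinderPath.angleSum_edges_of_isSimple hN h]
    simp
  | cycle γ γ' ε hd _ ih =>
    rw [CylinderPath.turnProduct_of_decomposesInto hN hd, ← ih]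
    simp

end FlatPerfectNetwork

end TurningNumbers

theorem proposition4 (Λ : Submodule ℤ ℂ) [DiscreteTopology Λ] [IsZLattice ℝ Λ]
    {V E : Type*} [Finite V] [Finite E] (N : FlatPerfectNetwork Λ V E)
    (R : SimpleLoop Λ) (v : ℂ) (hN : N.IsNormalized R v) (γ : N.CylinderPath R) :
    ∃ ε : ℤˣ, (∀ δ : ℤˣ, FlatPerfectNetwork.HasSign γ δ ↔ δ = ε) ∧
      ((ε : ℤ) : ℂ) = γ.turnProduct := by
  obtain ⟨ε, hε⟩ := γ.exists_hasSign
  have h := hε.coe_eq_turnProduct hN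
  refine ⟨ε, fun δ => ⟨fun hδ => ?_, fun hδ => hδ ▸ hε⟩, h⟩
  -- Two signs of the same path both equal its turn product in ℂ.
  exact Units.ext (Int.cast_injective ((hδ.coe_eq_turnProduct hN).trans h.symm))
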